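/- Let $n\ge 0$ and let $S_n$ be the symmetric group with simple generators $s_i=(i\ i{+}1)$, $1\le i<n$, and length function $\ell$; put $\ell(u,v)=\ell(v)-\ell(u)$. The Bruhat order $\le$ on $S_n$ is defined by $x\le y$ if and only if there is a (possibly empty) chain $x=x_0\to x_1\to\cdots\to x_k=y$, where $x\to y$ means that $yx^{-1}$ is a transposition and $\ell(x)<\ell(y)$; write $[u,v]=\{x : u\le x\le v\}$. Let $R_{u,v}\in\mathbb{Z}[q]$ $(u,v\in S_n)$ be the Kazhdan--Lusztig $R$-polynomials, i.e. the unique family of polynomials with $R_{u,v}=0$ if $u\not\le v$, $R_{u,u}=1$, and, whenever $u<v$ and $s$ is a simple generator with $sv<v$, \[ R_{u,v}=\begin{cases} R_{su,sv} & \text{if } su<u,\\ (q-1)R_{u,sv}+qR_{su,sv} & \text{if } su>u.\end{cases} \] Let $\widetilde R_{u,v}\in\mathbb{Z}[q]$ be the unique polynomial with $R_{u,v}(q)=q^{\ell(u,v)/2}\,\widetilde R_{u,v}(q^{1/2}-q^{-1/2})$. For $x,y\in S_n$ and an order ideal (down-closed subset) $J$ of $[x,y]$, the relative $\widetilde R$-polynomial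 is \[ \widetilde R_{x,y,J}=\sum_{z\in J}\widetilde R_{x,z}(-q)\,\widetilde R_{z,y}(q), \] and if $I$ is an order ideal of $[u,v]$ and $x,y\in[u,v]$, we write $\widetilde R_{x,y,I}$ for $\widetilde R_{x,y,I\cap[x,y]}$. Then for all $u,v\in S_n$ and every nonempty order ideal $I$ of $[u,v]$, \[ \widetilde R_{u,v}=\sum_{x\in I}\widetilde R_{u,x}\,\widetilde R_{x,v,I}. \] -/

import Mathlib

open Polynomial

namespace SymBruhat

/-- The simple generators of `S_n`: the adjacent transpositions `(i i+1)`. -/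
def IsSimple {n : ℕ} (s : Equiv.Perm (Fin n)) : Prop :=
  ∃ i j : Fin n, (i : ℕ) + 1 = (j : ℕ) ∧ s = Equiv.swap i j

/-- The Coxeter length: the least length of an expression of `w` as a product of simple
generators. -/
noncomputable def length {n : ℕ} (w : Equiv.Perm (Fin n)) : ℕ :=
  sInf {k : ℕ | ∃ l : List (Equiv.Perm (Fin n)),
    (∀ s ∈ l, IsSimple s) ∧ l.prod = w ∧ l.length = k}

/-- Edges `x → y` of the Bruhat graph: `y x⁻¹` is a reflection (in `S_n`, a transposition) and
`ℓ(x) < ℓ(y)`. -/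
def BruhatEdge {n : ℕ} (x y : Equiv.Perm (Fin n)) : Prop :=
  (y * x⁻¹).IsSwap ∧ length x < length y

/-- Bruhat order: there is a directed path from `x` to `y` in the Bruhat graph. -/
def BruhatLE {n : ℕ} (x y : Equiv.Perm (Fin n)) : Prop :=
  Relation.ReflTransGen BruhatEdge x y

/-- Strict Bruhat order. -/
def BruhatLT {n : ℕ} (x y : Equiv.Perm (Fin n)) : Prop :=
  BruhatLE x y ∧ x ≠ y

open Classical in
/-- The Bruhat interval `[u, v]`. -/
noncomputable def bruhatIcc {n : ℕ} (u v : Equiv.Perm (Fin n)) : Finset (Equiv.Perm (Fin n)) :=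
  Finset.univ.filter fun x => BruhatLE u x ∧ BruhatLE x v

/-- `I` is an order ideal (down-closed subset) of the Bruhat interval `[u, v]`. -/
def IsOrderIdeal {n : ℕ} (u v : Equiv.Perm (Fin n)) (I : Finset (Equiv.Perm (Fin n))) : Prop :=
  I ⊆ bruhatIcc u v ∧ ∀ x ∈ I, ∀ y ∈ bruhatIcc u v, BruhatLE y x → y ∈ I

theorem IsSimple.isSwap {n : ℕ} {s : Equiv.Perm (Fin n)} (hs : IsSimple s) : s.IsSwap := by
  obtain ⟨i, j, hij, rfl⟩ := hs
  refine ⟨i, j, ?_, rfl⟩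
  rintro rfl
  omega

theorem IsSimple.mul_self {n : ℕ} {s : Equiv.Perm (Fin n)} (hs : IsSimple s) : s * s = 1 := by
  obtain ⟨i, j, -, rfl⟩ := hs
  exact Equiv.swap_mul_self i j

theorem exists_word {n : ℕ} (w : Equiv.Perm (Fin n)) :
    ∃ l : List (Equiv.Perm (Fin n)), (∀ s ∈ l, IsSimple s) ∧ l.prod = w := by
  cases n with
  | zero => exact ⟨[], by simp, Subsingleton.elim _ _⟩
  | succ m =>
    have h : w ∈ Submonoid.closure
        (Set.range fun i : Fin m => Equiv.swap i.castSucc i.succ) := by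
      rw [Equiv.Perm.mclosure_swap_castSucc_succ]; trivial
    obtain ⟨l, hl, hw⟩ := Submonoid.exists_list_of_mem_closure h
    refine ⟨l, fun s hs => ?_, hw⟩
    obtain ⟨i, rfl⟩ := hl s hs
    exact ⟨i.castSucc, i.succ, by simp, rfl⟩

theorem exists_reduced_word {n : ℕ} (w : Equiv.Perm (Fin n)) :
    ∃ l : List (Equiv.Perm (Fin n)),
      (∀ s ∈ l, IsSimple s) ∧ l.prod = w ∧ l.length = length w := by
  obtain ⟨l, hl, hw⟩ := exists_word w
  exact Nat.sInf_mem (s := {k : ℕ | ∃ l : List (Equiv.Perm (Fin n)),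
    (∀ s ∈ l, IsSimple s) ∧ l.prod = w ∧ l.length = k}) ⟨l.length, l, hl, hw, rfl⟩

theorem length_prod_le {n : ℕ} (l : List (Equiv.Perm (Fin n))) (hl : ∀ s ∈ l, IsSimple s) :
    length l.prod ≤ l.length :=
  Nat.sInf_le ⟨l, hl, rfl, rfl⟩

theorem length_simple_mul_le {n : ℕ} {s : Equiv.Perm (Fin n)} (hs : IsSimple s)
    (w : Equiv.Perm (Fin n)) : length (s * w) ≤ length w + 1 := by
  obtain ⟨l, hl, hw, hk⟩ := exists_reduced_word w
  have := length_prod_le (s :: l) (by simpa using ⟨hs, hl⟩)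
  rw [List.prod_cons, hw, List.length_cons, hk] at this
  exact this

theorem sign_eq {n : ℕ} (w : Equiv.Perm (Fin n)) : Equiv.Perm.sign w = (-1) ^ length w := by
  obtain ⟨l, hl, hw, hk⟩ := exists_reduced_word w
  rw [← hk, ← hw]
  exact Equiv.Perm.sign_prod_list_swap fun s hs => (hl s hs).isSwap

theorem length_simple_mul {n : ℕ} {s : Equiv.Perm (Fin n)} (hs : IsSimple s)
    (w : Equiv.Perm (Fin n)) :
    length (s * w) = length w + 1 ∨ length (s * w) + 1 = length w := by
  have h1 := length_simple_mul_le hs w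
  have h2 := length_simple_mul_le hs (s * w)
  rw [← mul_assoc, hs.mul_self, one_mul] at h2
  have h3 : length (s * w) ≠ length w := by
    intro h
    have h4 := sign_eq (s * w)
    rw [h, ← sign_eq w, Equiv.Perm.sign_mul, hs.isSwap.sign_eq] at h4
    rcases Int.units_eq_one_or (Equiv.Perm.sign w) with h5 | h5 <;> rw [h5] at h4 <;>
      exact absurd h4 (by decide)
  omega

theorem BruhatLE.length_le {n : ℕ} {x y : Equiv.Perm (Fin n)} (h : BruhatLE x y) :
    length x ≤ length y := by
  induction h with
  | refl => exact le_rfl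
  | tail _ h ih => exact ih.trans h.2.le

theorem BruhatLT.length_lt {n : ℕ} {x y : Equiv.Perm (Fin n)} (h : BruhatLT x y) :
    length x < length y := by
  obtain ⟨h, hne⟩ := h
  rcases Relation.ReflTransGen.cases_tail h with h | ⟨z, hz, hzy⟩
  · exact absurd h.symm hne
  · exact (BruhatLE.length_le hz).trans_lt hzy.2

theorem bruhatLT_simple_mul {n : ℕ} {s : Equiv.Perm (Fin n)} (hs : IsSimple s)
    {w : Equiv.Perm (Fin n)} (h : length (s * w) < length w) : BruhatLT (s * w) w := by
  refine ⟨Relation.ReflTransGen.single ⟨?_, h⟩, fun e => by rw [e] at h; exact lt_irrefl _ h⟩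
  have : w * (s * w)⁻¹ = s := by
    rw [mul_inv_rev, mul_inv_cancel_left]
    exact inv_eq_of_mul_eq_one_left hs.mul_self
  rw [this]
  exact hs.isSwap

/-- Every element that is not minimal has a left descent. -/
theorem exists_descent {n : ℕ} {u v : Equiv.Perm (Fin n)} (h : BruhatLT u v) :
    ∃ s : Equiv.Perm (Fin n), IsSimple s ∧ BruhatLT (s * v) v := by
  obtain ⟨l, hl, hw, hk⟩ := exists_reduced_word v
  cases l with
  | nil =>
    have := h.length_lt
    simp at hk
    omega
  | cons s l =>
    have hs : IsSimple s := hl s (by simp)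
    refine ⟨s, hs, bruhatLT_simple_mul hs ?_⟩
    have h2 : s * v = l.prod := by
      rw [← hw, List.prod_cons, ← mul_assoc, hs.mul_self, one_mul]
    have h3 := length_prod_le l fun t ht => hl t (by simp [ht])
    rw [h2]
    simp at hk
    omega

open Classical in
/-- The Kazhdan–Lusztig `R`-polynomials, computed by their defining recursion: `R_{u,v} = 0` if
`u ≰ v`, `R_{u,u} = 1`, and for `u < v` and a simple `s` with `sv < v`,
`R_{u,v} = R_{su,sv}` if `su < u` and `R_{u,v} = (q-1) R_{u,sv} + q R_{su,sv}` if `su > u`.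
The (arbitrary) left descent `s` of `v` is picked by choice; by the theorem of Kazhdan and Lusztig
the outcome does not depend on it. -/
noncomputable def Rpoly {n : ℕ} (u v : Equiv.Perm (Fin n)) : ℤ[X] :=
  if u = v then 1
  else if h : BruhatLT u v then
    if BruhatLT ((exists_descent h).choose * u) u then
      Rpoly ((exists_descent h).choose * u) ((exists_descent h).choose * v)
    else
      (X - 1) * Rpoly u ((exists_descent h).choose * v) +
        X * Rpoly ((exists_descent h).choose * u) ((exists_descent h).choose * v)
  else 0
termination_by length v
decreasing_by all_goals exact (exists_descent h).choose_spec.2.length_lt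

/-- `P` is the `R̃`-polynomial of `(u, v)`: `R_{u,v}(q) = q^{ℓ(u,v)/2} P(q^{1/2} - q^{-1/2})`, with
`ℓ(u,v) = ℓ(v) - ℓ(u)`, an identity of Laurent polynomials in `T = q^{1/2}`. -/
def IsRtilde {n : ℕ} (u v : Equiv.Perm (Fin n)) (P : ℤ[X]) : Prop :=
  aeval (LaurentPolynomial.T 2 : LaurentPolynomial ℤ) (Rpoly u v) =
    LaurentPolynomial.T ((length v : ℤ) - (length u : ℤ)) *
      aeval (LaurentPolynomial.T 1 - LaurentPolynomial.T (-1) : LaurentPolynomial ℤ) P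

theorem exists_isRtilde {n : ℕ} (u v : Equiv.Perm (Fin n)) : ∃ P : ℤ[X], IsRtilde u v P := by
  induction hk : length v using Nat.strong_induction_on generalizing u v with
  | _ k ih =>
  subst hk
  by_cases huv : u = v
  · subst huv
    exact ⟨1, by unfold IsRtilde; rw [Rpoly]; simp⟩
  by_cases h : BruhatLT u v
  swap
  · exact ⟨0, by unfold IsRtilde; rw [Rpoly]; simp [huv, h]⟩
  obtain ⟨hs, hv⟩ := (exists_descent h).choose_spec
  have hR := Rpoly.eq_def u v
  rw [if_neg huv, dif_pos h] at hR
  generalize (exists_descent h).choose = s at hs hv hR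
  have hlv := hv.length_lt
  have hlv' := length_simple_mul hs v
  have hlu' := length_simple_mul hs u
  obtain ⟨P, hP⟩ := ih _ hlv (s * u) (s * v) rfl
  obtain ⟨Q, hQ⟩ := ih _ hlv u (s * v) rfl
  unfold IsRtilde at hP hQ
  by_cases hu : BruhatLT (s * u) u
  · refine ⟨P, ?_⟩
    unfold IsRtilde
    have hlu := hu.length_lt
    rw [hR, if_pos hu, hP]
    congr 2
    omega
  · refine ⟨X * Q + P, ?_⟩
    have hlu : ¬ length (s * u) < length u := fun h => hu (bruhatLT_simple_mul hs h)
    unfold IsRtilde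
    have e1 : ((length (s * v) : ℤ) - length u) = ((length v : ℤ) - length u) + (-1) := by omega
    have e2 : ((length (s * v) : ℤ) - length (s * u)) = ((length v : ℤ) - length u) + (-2) := by
      omega
    rw [hR, if_neg hu, map_add, map_mul, map_mul, hP, hQ, e1, e2, LaurentPolynomial.T_add,
      LaurentPolynomial.T_add]
    simp only [map_sub, map_one, aeval_X, map_add, map_mul]
    have f1 : (LaurentPolynomial.T 2 : LaurentPolynomial ℤ) * LaurentPolynomial.T (-2) = 1 := by
      rw [← LaurentPolynomial.T_add]; simp
    have f2 : ((LaurentPolynomial.T 2 : LaurentPolynomial ℤ) - 1) * LaurentPolynomial.T (-1) =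
        LaurentPolynomial.T 1 - LaurentPolynomial.T (-1) := by
      rw [sub_mul, ← LaurentPolynomial.T_add]; norm_num
    linear_combination
      LaurentPolynomial.T ((length v : ℤ) - length u) *
        aeval (LaurentPolynomial.T 1 - LaurentPolynomial.T (-1) : LaurentPolynomial ℤ) Q * f2 +
      LaurentPolynomial.T ((length v : ℤ) - length u) *
        aeval (LaurentPolynomial.T 1 - LaurentPolynomial.T (-1) : LaurentPolynomial ℤ) P * f1

theorem aeval_T_sub_T_injective : Function.Injective
    (aeval (LaurentPolynomial.T 1 - LaurentPolynomial.T (-1) : LaurentPolynomial ℤ) :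
      ℤ[X] → LaurentPolynomial ℤ) := by
  refine (injective_iff_map_eq_zero _).2 fun P hP => ?_
  have key : ∀ y : ℝ, aeval y P = 0 := by
    intro y
    have hpos : 0 < (y + √(y ^ 2 + 4)) / 2 := by
      have : |y| < √(y ^ 2 + 4) := by
        rw [← Real.sqrt_sq_eq_abs]
        exact Real.sqrt_lt_sqrt (sq_nonneg y) (by linarith)
      have := (abs_lt.1 this).1
      linarith
    set t : ℝ := (y + √(y ^ 2 + 4)) / 2 with ht
    have hy : t - t⁻¹ = y := by
      have hsq : √(y ^ 2 + 4) ^ 2 = y ^ 2 + 4 := Real.sq_sqrt (by positivity)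
      have h2 : t ^ 2 - 1 = y * t := by rw [ht]; linear_combination hsq / 4
      field_simp
      linarith
    have h := congrArg (LaurentPolynomial.eval₂ (Int.castRingHom ℝ) (Units.mk0 t hpos.ne')) hP
    rw [aeval_def, hom_eval₂] at h
    simp only [map_sub, map_zero, LaurentPolynomial.eval₂_T] at h
    rw [aeval_def, ← hy]
    convert h using 2
    · exact RingHom.ext_int _ _
    · simp
  have h2 : P.map (Int.castRingHom ℝ) = 0 := by
    refine Polynomial.funext fun y => ?_
    rw [eval_map, eval_zero]
    exact key y
  exact (Polynomial.map_eq_zero_iff Int.cast_injective).1 h2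

theorem existsUnique_isRtilde {n : ℕ} (u v : Equiv.Perm (Fin n)) :
    ∃! P : ℤ[X], IsRtilde u v P := by
  obtain ⟨P, hP⟩ := exists_isRtilde u v
  refine ⟨P, hP, fun Q hQ => aeval_T_sub_T_injective ?_⟩
  have h := hQ.symm.trans hP
  have h2 := congrArg
    (fun z => LaurentPolynomial.T (-((length v : ℤ) - (length u : ℤ))) * z) h
  simpa only [← mul_assoc, ← LaurentPolynomial.T_add, neg_add_cancel, LaurentPolynomial.T_zero,
    one_mul] using h2

/-- The `R̃`-polynomial `R̃_{u,v}`: the unique polynomial with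
`R_{u,v}(q) = q^{ℓ(u,v)/2} R̃_{u,v}(q^{1/2} - q^{-1/2})`. -/
noncomputable def Rtilde {n : ℕ} (u v : Equiv.Perm (Fin n)) : ℤ[X] :=
  (existsUnique_isRtilde u v).choose

/-- The relative `R̃`-polynomial `R̃_{u,v,I} = ∑_{x ∈ I} R̃_{u,x}(-q) R̃_{x,v}(q)` of `[u, v]` with
respect to an order ideal `I` of `[u, v]`. -/
noncomputable def relRtilde {n : ℕ} (u v : Equiv.Perm (Fin n))
    (I : Finset (Equiv.Perm (Fin n))) : ℤ[X] :=
  ∑ x ∈ I, (Rtilde u x).comp (-X) * Rtilde x v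

end SymBruhat

/-! Expand the relative polynomials and exchange the two sums: the right-hand side becomes the sum
over `z ∈ I` of `R̃_{z,v}` times `∑_{x ∈ I} R̃_{u,x}(q) R̃_{x,z}(-q)`. A nonzero term of the inner
sum has `u ≤ x ≤ z`, so down-closure lets `x` run over the whole group. The matrices `R̃(q)` and
`R̃(-q)` are inverse to each other (`sum_Rtilde_mul_Rtilde_comp_neg`), so the inner sum is
`δ_{u,z}`. Since `u ∈ I`, only `R̃_{u,v}` remains.

Inversion is proved by induction on `z`, moving a simple `s` from one index to the other
(`Rtilde_simple_mul_right`). This needs the recursion for every left descent, whereas `Rpoly` uses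
one chosen descent. Independence of the choice (`RtildeCol_eq_leftOp`) comes from the Hecke algebra
with generators `H_s² = 1 + q H_s`: the column `u ↦ R̃_{u,v}` gives the coordinates of `H_v` in the
basis `(H_{u⁻¹})⁻¹`. Left and right multiplications commute, which determines the operator of left
multiplication by `H_v` without reference to a reduced word.

The combinatorial input, namely the lifting property and the comparison of left and right ascents,
is read off from inversions. -/

namespace SymBruhat

variable {n : ℕ}

/-! ### Length as the number of inversions. -/

/-- The set of inversions of `w`, recorded by values: pairs `a < b` such that `b` occurs to the
left of `a` in `w`. -/
def inversions (w : Equiv.Perm (Fin n)) : Finset (Fin n × Fin n) :=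
  Finset.univ.filter fun p => p.1 < p.2 ∧ w⁻¹ p.2 < w⁻¹ p.1

theorem mem_inversions {w : Equiv.Perm (Fin n)} {a b : Fin n} :
    (a, b) ∈ inversions w ↔ a < b ∧ w⁻¹ b < w⁻¹ a := by
  simp [inversions]

/-- An adjacent transposition preserves the order of every pair but the one it exchanges. -/
theorem swap_lt_swap_of_adjacent {i j : Fin n} (hij : (i : ℕ) + 1 = j) {a b : Fin n} (hab : a < b)
    (hne : ¬(a = i ∧ b = j)) : Equiv.swap i j a < Equiv.swap i j b := by
  simp only [Equiv.swap_apply_def]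
  simp only [Fin.lt_def, Fin.ext_iff] at *
  split_ifs <;> omega

/-- Exchanging the adjacent values relabels the inversions of `w` bijectively onto those of the
product other than `(i, j)`. -/
theorem card_inversions_swap_mul {i j : Fin n} (hij : (i : ℕ) + 1 = j) {w : Equiv.Perm (Fin n)}
    (h : w⁻¹ i < w⁻¹ j) :
    (inversions (Equiv.swap i j * w)).card = (inversions w).card + 1 := by
  have hlt : i < j := by rw [Fin.lt_def]; omega
  have hmem : (i, j) ∈ inversions (Equiv.swap i j * w) := by
    rw [mem_inversions]
    exact ⟨hlt, by simpa using h⟩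
  rw [← Finset.card_erase_add_one hmem]
  congr 1
  refine Finset.card_nbij' (Prod.map (Equiv.swap i j) (Equiv.swap i j))
    (Prod.map (Equiv.swap i j) (Equiv.swap i j)) ?_ ?_ ?_ ?_
  · rintro ⟨a, b⟩ hp
    simp only [Finset.coe_erase, Set.mem_sdiff, Finset.mem_coe, mem_inversions,
      Set.mem_singleton_iff, Prod.mk.injEq, mul_inv_rev, Equiv.swap_inv,
      Equiv.Perm.mul_apply] at hp
    simp only [Prod.map_apply, Finset.mem_coe, mem_inversions]
    exact ⟨swap_lt_swap_of_adjacent hij hp.1.1 hp.2, hp.1.2⟩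
  · rintro ⟨a, b⟩ hp
    simp only [Finset.mem_coe, mem_inversions] at hp
    have hne : ¬(a = i ∧ b = j) := by
      rintro ⟨rfl, rfl⟩
      exact lt_asymm h hp.2
    simp only [Finset.coe_erase, Set.mem_sdiff, Finset.mem_coe, mem_inversions, Prod.map_apply,
      Set.mem_singleton_iff, Prod.mk.injEq, mul_inv_rev, Equiv.swap_inv,
      Equiv.Perm.mul_apply, Equiv.swap_apply_self]
    refine ⟨⟨swap_lt_swap_of_adjacent hij hp.1 hne, hp.2⟩, ?_⟩
    rintro ⟨h1, h2⟩
    rw [Equiv.swap_apply_eq_iff, Equiv.swap_apply_left] at h1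
    rw [Equiv.swap_apply_eq_iff, Equiv.swap_apply_right] at h2
    rw [h1, h2] at hp
    exact lt_asymm hlt hp.1
  · rintro ⟨a, b⟩ -
    simp
  · rintro ⟨a, b⟩ -
    simp

theorem card_inversions_of_lt {i j : Fin n} (hij : (i : ℕ) + 1 = j) {w : Equiv.Perm (Fin n)}
    (h : w⁻¹ j < w⁻¹ i) :
    (inversions w).card = (inversions (Equiv.swap i j * w)).card + 1 := by
  have := card_inversions_swap_mul hij (w := Equiv.swap i j * w) (by simpa using h)
  rwa [Equiv.swap_mul_self_mul] at this

theorem card_inversions_le_length (w : Equiv.Perm (Fin n)) :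
    (inversions w).card ≤ length w := by
  obtain ⟨l, hl, rfl, hk⟩ := exists_reduced_word w
  rw [← hk]
  clear hk
  induction l with
  | nil =>
    have : inversions (1 : Equiv.Perm (Fin n)) = ∅ := by
      ext ⟨a, b⟩
      simp only [mem_inversions, inv_one, Equiv.Perm.one_apply, Finset.notMem_empty, iff_false]
      exact fun h => lt_asymm h.1 h.2
    simp [this]
  | cons s l ih =>
    obtain ⟨i, j, hij, rfl⟩ := hl s (by simp)
    have ih := ih fun t ht => hl t (by simp [ht])
    rw [List.prod_cons, List.length_cons]
    have hne : l.prod⁻¹ i ≠ l.prod⁻¹ j := fun h => by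
      have := congrArg Fin.val (l.prod⁻¹.injective h)
      omega
    rcases lt_or_gt_of_ne hne with h | h
    · rw [card_inversions_swap_mul hij h]
      omega
    · have := card_inversions_of_lt hij h
      omega

/-- Otherwise `w⁻¹` is strictly increasing, and an increasing bijection of `Fin n` is the identity.
-/
theorem exists_adjacent_inversion {w : Equiv.Perm (Fin n)} (hw : w ≠ 1) :
    ∃ i j : Fin n, (i : ℕ) + 1 = j ∧ w⁻¹ j < w⁻¹ i := by
  by_contra! hcon
  apply hw
  cases n with
  | zero => exact Subsingleton.elim _ _
  | succ m =>
    have hmono : StrictMono (w⁻¹ : Equiv.Perm (Fin (m + 1))) := by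
      refine Fin.strictMono_iff_lt_succ.2 fun i => lt_of_le_of_ne (hcon _ _ (by simp)) fun h => ?_
      exact i.castSucc_lt_succ.ne (w⁻¹.injective h)
    have : ⇑(w⁻¹ : Equiv.Perm (Fin (m + 1))) = id :=
      (hmono.range_inj strictMono_id).1 (by rw [w⁻¹.surjective.range_eq, Set.range_id])
    rw [← inv_eq_one]
    exact Equiv.ext fun x => congrFun this x

theorem length_one : length (1 : Equiv.Perm (Fin n)) = 0 :=
  Nat.le_zero.1 (length_prod_le [] (by simp))

theorem length_le_card_inversions (w : Equiv.Perm (Fin n)) :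
    length w ≤ (inversions w).card := by
  induction hk : (inversions w).card using Nat.strong_induction_on generalizing w with
  | _ k ih =>
  by_cases hw : w = 1
  · rw [hw, length_one]
    exact Nat.zero_le _
  obtain ⟨i, j, hij, h⟩ := exists_adjacent_inversion hw
  have h1 := card_inversions_of_lt hij h
  have h2 := ih _ (by omega) (Equiv.swap i j * w) rfl
  have h3 := length_simple_mul_le ⟨i, j, hij, rfl⟩ (Equiv.swap i j * w)
  rw [Equiv.swap_mul_self_mul] at h3
  omega

/-- The length of a permutation is its number of inversions. -/
theorem length_eq_card_inversions (w : Equiv.Perm (Fin n)) : length w = (inversions w).card :=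
  le_antisymm (length_le_card_inversions w) (card_inversions_le_length w)

theorem length_simple_mul_lt_iff {i j : Fin n} (hij : (i : ℕ) + 1 = j) {w : Equiv.Perm (Fin n)} :
    length (Equiv.swap i j * w) < length w ↔ w⁻¹ j < w⁻¹ i := by
  have hne : w⁻¹ i ≠ w⁻¹ j := fun h => by
    have := congrArg Fin.val (w⁻¹.injective h)
    omega
  rw [length_eq_card_inversions, length_eq_card_inversions]
  rcases lt_or_gt_of_ne hne with h | h
  · have := card_inversions_swap_mul hij h
    exact iff_of_false (by omega) (lt_asymm h)
  · have := card_inversions_of_lt hij h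
    exact iff_of_true (by omega) h

theorem length_lt_length_simple_mul_iff {i j : Fin n} (hij : (i : ℕ) + 1 = j)
    {w : Equiv.Perm (Fin n)} :
    length w < length (Equiv.swap i j * w) ↔ w⁻¹ i < w⁻¹ j := by
  have := length_simple_mul_lt_iff hij (w := Equiv.swap i j * w)
  rw [Equiv.swap_mul_self_mul] at this
  simpa using this

/-! ### Transpositions, Bruhat edges and the lifting property. -/

/-- Left multiplication by a transposition `(a b)` increases the length when `a < b` occur in
this order in `x`. -/
theorem length_lt_length_swap_mul {a b : Fin n} (hab : a < b) {x : Equiv.Perm (Fin n)}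
    (h : x⁻¹ a < x⁻¹ b) : length x < length (Equiv.swap a b * x) := by
  induction hk : (b : ℕ) - a using Nat.strong_induction_on generalizing a b x with
  | _ k ih =>
  have hab' : (a : ℕ) < b := hab
  by_cases hadj : (a : ℕ) + 1 = b
  · exact (length_lt_length_simple_mul_iff hadj).2 h
  obtain ⟨c, hc⟩ : ∃ c : Fin n, (a : ℕ) + 1 = c := ⟨⟨a + 1, by omega⟩, rfl⟩
  have hac : a ≠ c := fun e => by rw [e] at hc; omega
  have hbc : b ≠ c := fun e => by rw [e] at hadj; omega
  have hcb : c < b := by rw [Fin.lt_def]; omega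
  have hs : IsSimple (Equiv.swap a c) := ⟨a, c, hc, rfl⟩
  -- Conjugation by `s = (a c)` turns `(a b)` into the shorter transposition `(c b)`, to which the
  -- induction applies.
  have hconj : Equiv.swap c b * (Equiv.swap a c * x) = Equiv.swap a c * (Equiv.swap a b * x) := by
    rw [← mul_assoc, ← mul_assoc]
    congr 1
    rw [Equiv.mul_swap_eq_swap_mul (Equiv.swap a c), Equiv.swap_apply_left,
      Equiv.swap_apply_of_ne_of_ne hab.ne' hbc]
  have key := ih ((b : ℕ) - c) (by omega) hcb (x := Equiv.swap a c * x)
    (by simpa [Equiv.swap_apply_of_ne_of_ne hab.ne' hbc] using h) rfl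
  rw [hconj] at key
  have h1 := length_simple_mul hs x
  have h2 := length_simple_mul hs (Equiv.swap a b * x)
  -- Removing `s` changes each of the two lengths by one. The gap in `key` can shrink only in the
  -- case excluded here, which would place `b` before `c` and `c` before `a` in `x`.
  have h3 : ¬(length (Equiv.swap a c * x) < length x ∧
      length (Equiv.swap a b * x) < length (Equiv.swap a c * (Equiv.swap a b * x))) := by
    rw [length_simple_mul_lt_iff hc, length_lt_length_simple_mul_iff hc]
    simp only [mul_inv_rev, Equiv.swap_inv, Equiv.Perm.mul_apply, Equiv.swap_apply_left,
      Equiv.swap_apply_of_ne_of_ne hac.symm hbc.symm]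
    exact fun h4 => lt_asymm (h4.2.trans h4.1) h
  omega

theorem length_lt_length_swap_mul_iff {a b : Fin n} (hab : a < b) {x : Equiv.Perm (Fin n)} :
    length x < length (Equiv.swap a b * x) ↔ x⁻¹ a < x⁻¹ b := by
  refine ⟨fun h => ?_, length_lt_length_swap_mul hab⟩
  by_contra hcon
  have hlt : x⁻¹ b < x⁻¹ a := lt_of_le_of_ne (not_lt.1 hcon) fun e => hab.ne' (x⁻¹.injective e)
  have := length_lt_length_swap_mul hab (x := Equiv.swap a b * x) (by simpa using hlt)
  rw [Equiv.swap_mul_self_mul] at this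
  exact lt_asymm h this

/-- Left multiplication by a simple generator `s` carries a Bruhat edge to a Bruhat edge unless
the edge is itself given by `s`. -/
theorem BruhatEdge.simple_mul {s x y : Equiv.Perm (Fin n)} (hs : IsSimple s)
    (h : BruhatEdge x y) (hne : s * x ≠ y) : BruhatEdge (s * x) (s * y) := by
  obtain ⟨⟨a, b, hab, ht⟩, hl⟩ := h
  wlog hlt : a < b generalizing a b
  · exact this b a hab.symm (by rw [ht, Equiv.swap_comm])
      (lt_of_le_of_ne (not_lt.1 hlt) hab.symm)
  obtain ⟨i, j, hij, rfl⟩ := hs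
  obtain rfl : y = Equiv.swap a b * x := by rw [← ht, inv_mul_cancel_right]
  have hlt' := swap_lt_swap_of_adjacent hij hlt (by rintro ⟨rfl, rfl⟩; exact hne rfl)
  have hconj : Equiv.swap i j * (Equiv.swap a b * x) =
      Equiv.swap (Equiv.swap i j a) (Equiv.swap i j b) * (Equiv.swap i j * x) := by
    rw [← mul_assoc, ← mul_assoc, Equiv.mul_swap_eq_swap_mul]
  refine ⟨⟨_, _, hlt'.ne, by rw [hconj, mul_inv_cancel_right]⟩, ?_⟩
  rw [hconj, length_lt_length_swap_mul_iff hlt']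
  rw [length_lt_length_swap_mul_iff hlt] at hl
  simpa using hl

theorem bruhatLE_simple_mul_of_length_lt {s w : Equiv.Perm (Fin n)} (hs : IsSimple s)
    (h : length w < length (s * w)) : BruhatLE w (s * w) := by
  have := (bruhatLT_simple_mul hs (w := s * w) (by rwa [← mul_assoc, hs.mul_self, one_mul])).1
  rwa [← mul_assoc, hs.mul_self, one_mul] at this

/-- The lifting property: `x ≤ y` and `y < s y` imply `s x ≤ s y`. -/
theorem BruhatLE.simple_mul {s x y : Equiv.Perm (Fin n)} (hs : IsSimple s) (h : BruhatLE x y)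
    (hy : length y < length (s * y)) : BruhatLE (s * x) (s * y) := by
  induction h using Relation.ReflTransGen.head_induction_on with
  | refl => exact Relation.ReflTransGen.refl
  | head hxz hzy ih =>
    rename_i x z
    -- The edge given by `s` itself is not carried to an edge, but then `s x = z ≤ y ≤ s y`
    -- directly.
    by_cases hne : s * x = z
    · rw [hne]
      exact hzy.trans (bruhatLE_simple_mul_of_length_lt hs hy)
    · exact Relation.ReflTransGen.head (hxz.simple_mul hs hne) ih

/-! ### Left and right ascents. -/

theorem length_inv (w : Equiv.Perm (Fin n)) : length w⁻¹ = length w := by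
  have key : ∀ w : Equiv.Perm (Fin n), length w⁻¹ ≤ length w := fun w => by
    obtain ⟨l, hl, hw, hk⟩ := exists_reduced_word w
    have hl' : l.map (·⁻¹) = l := by
      conv_rhs => rw [← List.map_id l]
      exact List.map_congr_left fun s hs => inv_eq_of_mul_eq_one_left (hl s hs).mul_self
    have h := length_prod_le l.reverse fun s hs => hl s (List.mem_reverse.1 hs)
    rw [List.length_reverse, hk] at h
    rw [← hw, List.prod_inv_reverse, hl']
    rwa [← hw] at h
  refine le_antisymm (key w) ?_
  simpa using key w⁻¹

theorem IsSimple.mul_mul_cancel_left {s : Equiv.Perm (Fin n)} (hs : IsSimple s)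
    (w : Equiv.Perm (Fin n)) : s * (s * w) = w := by
  rw [← mul_assoc, hs.mul_self, one_mul]

theorem IsSimple.mul_mul_cancel_right {s : Equiv.Perm (Fin n)} (hs : IsSimple s)
    (w : Equiv.Perm (Fin n)) : w * s * s = w := by
  rw [mul_assoc, hs.mul_self, mul_one]

theorem IsSimple.inv_eq {s : Equiv.Perm (Fin n)} (hs : IsSimple s) : s⁻¹ = s :=
  inv_eq_of_mul_eq_one_left hs.mul_self

theorem length_mul_simple {t : Equiv.Perm (Fin n)} (ht : IsSimple t) (w : Equiv.Perm (Fin n)) :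
    length (w * t) = length (t * w⁻¹) := by
  rw [← length_inv (w * t), mul_inv_rev, ht.inv_eq]

/-- Whether `s = (i j)` is an ascent depends on the order of the positions `u⁻¹ i` and `u⁻¹ j`.
Applying `t` reverses that order only if `t` exchanges exactly these positions, that is, if `s u = u
t`. -/
theorem length_mul_simple_lt_of_lt {s t u : Equiv.Perm (Fin n)} (hs : IsSimple s)
    (ht : IsSimple t) (hne : s * u ≠ u * t) (h : length u < length (s * u)) :
    length (u * t) < length (s * (u * t)) := by
  obtain ⟨i, j, hij, rfl⟩ := hs
  obtain ⟨k, l, hkl, rfl⟩ := ht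
  rw [length_lt_length_simple_mul_iff hij] at h ⊢
  simp only [mul_inv_rev, Equiv.swap_inv, Equiv.Perm.mul_apply]
  refine swap_lt_swap_of_adjacent hkl h ?_
  rintro ⟨rfl, rfl⟩
  apply hne
  rw [Equiv.mul_swap_eq_swap_mul]
  simp

/-- Unless `s u = u t`, right multiplication by `t` does not change whether `s` is a left ascent. -/
theorem length_mul_simple_lt_iff {s t u : Equiv.Perm (Fin n)} (hs : IsSimple s)
    (ht : IsSimple t) (hne : s * u ≠ u * t) :
    length (u * t) < length (s * (u * t)) ↔ length u < length (s * u) := by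
  refine ⟨fun h => ?_, length_mul_simple_lt_of_lt hs ht hne⟩
  have := length_mul_simple_lt_of_lt hs ht (u := u * t) (fun e => hne ?_) h
  · rwa [ht.mul_mul_cancel_right] at this
  · rw [ht.mul_mul_cancel_right] at e
    rw [← hs.mul_mul_cancel_left (u * t), e]

theorem length_simple_mul_lt_iff_right {s t u : Equiv.Perm (Fin n)} (hs : IsSimple s)
    (ht : IsSimple t) (hne : s * u ≠ u * t) :
    length (s * u) < length (s * (u * t)) ↔ length u < length (u * t) := by
  have key := length_mul_simple_lt_iff ht hs (u := u⁻¹) fun e => hne <| by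
    have := congrArg (·⁻¹) e
    simp only [mul_inv_rev, inv_inv, ht.inv_eq, hs.inv_eq] at this
    exact this.symm
  rw [length_mul_simple hs, inv_inv, ← length_mul_simple ht, length_inv,
    ← length_inv (t * _)] at key
  simpa [mul_inv_rev, hs.inv_eq, ht.inv_eq, mul_assoc] using key

/-! ### Commuting left and right Hecke operators. -/

/-- Functions on `S_n` with polynomial values, the free `ℤ[q]`-module on `S_n`. -/
abbrev PermModule (n : ℕ) : Type := Equiv.Perm (Fin n) → ℤ[X]

/-- The operator of the normalised Hecke generator attached to `s`, acting on the left. -/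
noncomputable def leftOp (s : Equiv.Perm (Fin n)) : Module.End ℤ[X] (PermModule n) where
  toFun f u := f (s * u) + (if length u < length (s * u) then X else 0) * f u
  map_add' f g := by
    funext u
    simp only [Pi.add_apply]
    ring
  map_smul' c f := by
    funext u
    simp only [Pi.smul_apply, smul_eq_mul, RingHom.id_apply]
    ring

/-- The operator of the normalised Hecke generator attached to `t`, acting on the right. -/
noncomputable def rightOp (t : Equiv.Perm (Fin n)) : Module.End ℤ[X] (PermModule n) where
  toFun f u := f (u * t) + (if length u < length (u * t) then X else 0) * f u
  map_add' f g := by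
    funext u
    simp only [Pi.add_apply]
    ring
  map_smul' c f := by
    funext u
    simp only [Pi.smul_apply, smul_eq_mul, RingHom.id_apply]
    ring

theorem leftOp_apply (s : Equiv.Perm (Fin n)) (f : PermModule n) (u : Equiv.Perm (Fin n)) :
    leftOp s f u = f (s * u) + (if length u < length (s * u) then X else 0) * f u := rfl

theorem rightOp_apply (t : Equiv.Perm (Fin n)) (f : PermModule n) (u : Equiv.Perm (Fin n)) :
    rightOp t f u = f (u * t) + (if length u < length (u * t) then X else 0) * f u := rfl

/-- If `s u = u t`, the two composites agree at `u` term by term. Otherwise neither multiplication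
affects the ascent condition of the other. -/
theorem commute_leftOp_rightOp {s t : Equiv.Perm (Fin n)} (hs : IsSimple s) (ht : IsSimple t) :
    Commute (leftOp s) (rightOp t) := by
  refine LinearMap.ext fun f => funext fun u => ?_
  simp only [Module.End.mul_apply, leftOp_apply, rightOp_apply]
  by_cases h : s * u = u * t
  · simp only [h, mul_assoc]
    rw [← mul_assoc s u t, h, mul_assoc]
  · simp only [mul_assoc, length_mul_simple_lt_iff hs ht h,
      length_simple_mul_lt_iff_right hs ht h]
    ring

/-- This is the multiplication rule of `H_s` on the basis `(H_{x⁻¹})⁻¹`, in view of `H_s⁻¹ = H_s -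
q`. -/
theorem leftOp_single {s x : Equiv.Perm (Fin n)} (hs : IsSimple s) :
    leftOp s (Pi.single x 1) = Pi.single (s * x) 1 +
      (if length x < length (s * x) then X else 0 : ℤ[X]) • (Pi.single x 1 : PermModule n) := by
  funext u
  have h : s * u = x ↔ u = s * x :=
    ⟨fun h => by rw [← h, hs.mul_mul_cancel_left], fun h => by rw [h, hs.mul_mul_cancel_left]⟩
  simp only [leftOp_apply, Pi.add_apply, Pi.smul_apply, Pi.single_apply, smul_eq_mul, h]
  by_cases hu : u = x <;> simp [hu]

theorem rightOp_single {t x : Equiv.Perm (Fin n)} (ht : IsSimple t) :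
    rightOp t (Pi.single x 1) = Pi.single (x * t) 1 +
      (if length x < length (x * t) then X else 0 : ℤ[X]) • (Pi.single x 1 : PermModule n) := by
  funext u
  have h : u * t = x ↔ u = x * t :=
    ⟨fun h => by rw [← h, ht.mul_mul_cancel_right], fun h => by rw [h, ht.mul_mul_cancel_right]⟩
  simp only [rightOp_apply, Pi.add_apply, Pi.smul_apply, Pi.single_apply, smul_eq_mul, h]
  by_cases hu : u = x <;> simp [hu]

/-- An operator commuting with the right action is determined by its value at one basis vector. -/
theorem eq_of_commute_rightOp {A B : Module.End ℤ[X] (PermModule n)}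
    (hA : ∀ t, IsSimple t → Commute A (rightOp t)) (hB : ∀ t, IsSimple t → Commute B (rightOp t))
    {x : Equiv.Perm (Fin n)} (hx : A (Pi.single x 1) = B (Pi.single x 1)) : A = B := by
  have step : ∀ y t, IsSimple t → A (Pi.single y 1) = B (Pi.single y 1) →
      A (Pi.single (y * t) 1) = B (Pi.single (y * t) 1) := by
    intro y t ht hy
    -- The basis vector at `y t` is obtained from the one at `y` by the right operator and a scalar,
    -- both of which commute with `A` and `B`.
    have hr := eq_sub_of_add_eq (rightOp_single ht (x := y)).symm
    have h1 := LinearMap.congr_fun (hA t ht) (Pi.single y 1)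
    have h2 := LinearMap.congr_fun (hB t ht) (Pi.single y 1)
    simp only [Module.End.mul_apply] at h1 h2
    rw [hr, map_sub, map_sub, map_smul, map_smul, h1, h2, hy]
  have all : ∀ y, A (Pi.single y 1) = B (Pi.single y 1) := by
    intro y
    obtain ⟨l, hl, hy⟩ := exists_word (x⁻¹ * y)
    obtain rfl : y = x * l.prod := by rw [hy, mul_inv_cancel_left]
    clear hy
    induction l using List.reverseRecOn with
    | nil => simpa using hx
    | append_singleton l t ih =>
      rw [List.prod_append, List.prod_singleton, ← mul_assoc]
      exact step _ _ (hl t (by simp)) (ih fun r hr => hl r (by simp [hr]))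
  refine LinearMap.pi_ext' fun y => LinearMap.ext_ring ?_
  exact all y

/-! ### The recursion for the chosen descent. -/

theorem Rtilde_eq_of_isRtilde {u v : Equiv.Perm (Fin n)} {P : ℤ[X]} (h : IsRtilde u v P) :
    Rtilde u v = P :=
  (existsUnique_isRtilde u v).unique (existsUnique_isRtilde u v).choose_spec.1 h

theorem isRtilde_Rtilde (u v : Equiv.Perm (Fin n)) : IsRtilde u v (Rtilde u v) :=
  (existsUnique_isRtilde u v).choose_spec.1

theorem Rtilde_self (u : Equiv.Perm (Fin n)) : Rtilde u u = 1 :=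
  Rtilde_eq_of_isRtilde (by unfold IsRtilde; rw [Rpoly]; simp)

theorem Rtilde_eq_zero {u v : Equiv.Perm (Fin n)} (h : ¬BruhatLE u v) : Rtilde u v = 0 := by
  have huv : u ≠ v := fun e => h (e ▸ Relation.ReflTransGen.refl)
  have hlt : ¬BruhatLT u v := fun h' => h h'.1
  exact Rtilde_eq_of_isRtilde (by unfold IsRtilde; rw [Rpoly]; simp [huv, hlt])

/-- The column `u ↦ R̃_{u,v}`. -/
noncomputable def RtildeCol (v : Equiv.Perm (Fin n)) : PermModule n := fun u => Rtilde u v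

theorem eq_one_of_length_eq_zero {w : Equiv.Perm (Fin n)} (h : length w = 0) : w = 1 := by
  obtain ⟨l, -, hw, hk⟩ := exists_reduced_word w
  rw [h, List.length_eq_zero_iff] at hk
  rw [← hw, hk, List.prod_nil]

theorem RtildeCol_one : RtildeCol (1 : Equiv.Perm (Fin n)) = Pi.single 1 1 := by
  funext u
  by_cases hu : u = 1
  · rw [hu, Pi.single_eq_same]
    exact Rtilde_self 1
  · rw [Pi.single_eq_of_ne hu]
    refine Rtilde_eq_zero fun h => hu (eq_one_of_length_eq_zero ?_)
    have := h.length_le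
    rw [length_one] at this
    omega

theorem Rtilde_of_Rpoly_eq {s u v : Equiv.Perm (Fin n)} (hs : IsSimple s)
    (hv : length (s * v) < length v)
    (hR : Rpoly u v = if length (s * u) < length u then Rpoly (s * u) (s * v) else
      (X - 1) * Rpoly u (s * v) + X * Rpoly (s * u) (s * v)) :
    Rtilde u v = leftOp s (RtildeCol (s * v)) u := by
  have hlv := length_simple_mul hs v
  have hlu := length_simple_mul hs u
  have hP := isRtilde_Rtilde (s * u) (s * v)
  have hQ := isRtilde_Rtilde u (s * v)
  apply Rtilde_eq_of_isRtilde
  rw [leftOp_apply]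
  unfold RtildeCol
  unfold IsRtilde at hP hQ ⊢
  by_cases hu : length (s * u) < length u
  · rw [if_neg (lt_asymm hu), zero_mul, add_zero, hR, if_pos hu, hP]
    congr 2
    omega
  · rw [if_pos (by omega)]
    have e1 : ((length (s * v) : ℤ) - length u) = ((length v : ℤ) - length u) + (-1) := by omega
    have e2 : ((length (s * v) : ℤ) - length (s * u)) = ((length v : ℤ) - length u) + (-2) := by
      omega
    rw [hR, if_neg hu, map_add, map_mul, map_mul, hP, hQ, e1, e2, LaurentPolynomial.T_add,
      LaurentPolynomial.T_add]
    simp only [map_sub, map_one, aeval_X, map_add, map_mul]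
    have f1 : (LaurentPolynomial.T 2 : LaurentPolynomial ℤ) * LaurentPolynomial.T (-2) = 1 := by
      rw [← LaurentPolynomial.T_add]; simp
    have f2 : ((LaurentPolynomial.T 2 : LaurentPolynomial ℤ) - 1) * LaurentPolynomial.T (-1) =
        LaurentPolynomial.T 1 - LaurentPolynomial.T (-1) := by
      rw [sub_mul, ← LaurentPolynomial.T_add]; norm_num
    linear_combination
      LaurentPolynomial.T ((length v : ℤ) - length u) *
        aeval (LaurentPolynomial.T 1 - LaurentPolynomial.T (-1) : LaurentPolynomial ℤ)
          (Rtilde u (s * v)) * f2 +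
      LaurentPolynomial.T ((length v : ℤ) - length u) *
        aeval (LaurentPolynomial.T 1 - LaurentPolynomial.T (-1) : LaurentPolynomial ℤ)
          (Rtilde (s * u) (s * v)) * f1

theorem bruhatLT_simple_mul_iff {s w : Equiv.Perm (Fin n)} (hs : IsSimple s) :
    BruhatLT (s * w) w ↔ length (s * w) < length w :=
  ⟨BruhatLT.length_lt, bruhatLT_simple_mul hs⟩

open Classical in
/-- The recursion holds for the left descent used in the definition of `Rpoly`. -/
theorem exists_RtildeCol_eq_leftOp {v : Equiv.Perm (Fin n)} (hv : v ≠ 1) :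
    ∃ s, IsSimple s ∧ length (s * v) < length v ∧ RtildeCol v = leftOp s (RtildeCol (s * v)) := by
  obtain ⟨i, j, hij, hinv⟩ := exists_adjacent_inversion hv
  have h0 : BruhatLT (Equiv.swap i j * v) v :=
    bruhatLT_simple_mul ⟨i, j, hij, rfl⟩ ((length_simple_mul_lt_iff hij).2 hinv)
  obtain ⟨hs, hsv⟩ := (exists_descent h0).choose_spec
  -- The existence statement behind the choice mentions only `v`, so by proof irrelevance the same
  -- `s` serves every `u`.
  have hR : ∀ u, BruhatLT u v → Rpoly u v =
      if BruhatLT ((exists_descent h0).choose * u) u then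
        Rpoly ((exists_descent h0).choose * u) ((exists_descent h0).choose * v)
      else (X - 1) * Rpoly u ((exists_descent h0).choose * v) +
        X * Rpoly ((exists_descent h0).choose * u) ((exists_descent h0).choose * v) := fun u h => by
    rw [Rpoly.eq_def u v, if_neg h.2, dif_pos h]
  generalize (exists_descent h0).choose = s at hs hsv hR
  have hlv := hsv.length_lt
  refine ⟨s, hs, hlv, funext fun u => ?_⟩
  by_cases huv : u = v
  · subst huv
    rw [leftOp_apply, if_neg (lt_asymm hlv), zero_mul, add_zero]
    exact (Rtilde_self u).trans (Rtilde_self _).symm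
  by_cases h : BruhatLE u v
  · refine Rtilde_of_Rpoly_eq hs hlv ?_
    simp only [hR u ⟨h, huv⟩, bruhatLT_simple_mul_iff hs]
  -- Outside the support everything vanishes: `s u ≤ s v` would give `u ≤ v` by lifting.
  · have h1 : ¬BruhatLE u (s * v) := fun h' => h (h'.trans hsv.1)
    have h2 : ¬BruhatLE (s * u) (s * v) := fun h' => h <| by
      have := h'.simple_mul hs (by rwa [hs.mul_mul_cancel_left])
      rwa [hs.mul_mul_cancel_left, hs.mul_mul_cancel_left] at this
    rw [leftOp_apply]
    unfold RtildeCol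
    rw [Rtilde_eq_zero h, Rtilde_eq_zero h1, Rtilde_eq_zero h2, mul_zero, add_zero]

/-! ### Independence of the descent. -/

/-- If `A` commutes with the right action and sends `w⁻¹` to `1`, then `H_s A` sends `(s w)⁻¹`
to `1`, provided `w < s w`. -/
theorem leftOp_mul_apply_single {s w : Equiv.Perm (Fin n)} (hs : IsSimple s)
    (hw : length w < length (s * w)) {A : Module.End ℤ[X] (PermModule n)}
    (hA : ∀ t, IsSimple t → Commute A (rightOp t))
    (h : A (Pi.single w⁻¹ 1) = Pi.single 1 1) :
    (leftOp s * A) (Pi.single (s * w)⁻¹ 1) = Pi.single 1 1 := by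
  have hl1 : length (1 : Equiv.Perm (Fin n)) < length s := by
    have := length_simple_mul hs 1
    rw [mul_one, length_one] at this
    rw [length_one]
    omega
  have hlw : length w⁻¹ < length (w⁻¹ * s) := by
    rwa [length_mul_simple hs, inv_inv, length_inv]
  -- Writing the vector at `w⁻¹ s` through the right operator at `w⁻¹` lets `A` pass to the vector
  -- at `1`. The multiples of `X` cancel, leaving the vector at `s`, which `leftOp s` sends to `1`.
  have e := eq_sub_of_add_eq (rightOp_single hs (x := w⁻¹)).symm
  have hc := LinearMap.congr_fun (hA s hs) (Pi.single w⁻¹ 1)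
  simp only [Module.End.mul_apply] at hc
  rw [mul_inv_rev, hs.inv_eq, Module.End.mul_apply, e, map_sub, map_smul, hc, h,
    rightOp_single hs, if_pos hlw, one_mul, if_pos hl1, add_sub_cancel_right, leftOp_single hs,
    hs.mul_self, if_neg (lt_asymm hl1), zero_smul, add_zero]

/-- The operator `A` is left multiplication by `H_v`. Its value at `v⁻¹` expresses `H_v H_v⁻¹ = 1`
and pins it down; its value at `1` is the column of `R̃`-polynomials. -/
theorem exists_operator (v : Equiv.Perm (Fin n)) : ∃ A : Module.End ℤ[X] (PermModule n),
    (∀ t, IsSimple t → Commute A (rightOp t)) ∧ A (Pi.single v⁻¹ 1) = Pi.single 1 1 ∧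
      A (Pi.single 1 1) = RtildeCol v := by
  induction hk : length v using Nat.strong_induction_on generalizing v with
  | _ k ih =>
  subst hk
  by_cases hv : v = 1
  · subst hv
    exact ⟨1, fun t _ => Commute.one_left _, by rw [inv_one]; rfl, RtildeCol_one.symm⟩
  obtain ⟨s, hs, hlt, hrec⟩ := exists_RtildeCol_eq_leftOp hv
  obtain ⟨A, hA, hA1, hA2⟩ := ih _ hlt (s * v) rfl
  refine ⟨leftOp s * A, fun t ht => (commute_leftOp_rightOp hs ht).mul_left (hA t ht), ?_, ?_⟩
  · have := leftOp_mul_apply_single hs (by rwa [hs.mul_mul_cancel_left]) hA hA1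
    rwa [hs.mul_mul_cancel_left] at this
  · rw [Module.End.mul_apply, hA2, hrec]

/-- The recursion of the `R̃`-polynomials holds for every left descent. -/
theorem RtildeCol_eq_leftOp {s v : Equiv.Perm (Fin n)} (hs : IsSimple s)
    (hv : length (s * v) < length v) : RtildeCol v = leftOp s (RtildeCol (s * v)) := by
  obtain ⟨A, hA, hA1, hA2⟩ := exists_operator v
  obtain ⟨B, hB, hB1, hB2⟩ := exists_operator (s * v)
  have h := leftOp_mul_apply_single hs (by rwa [hs.mul_mul_cancel_left]) hB hB1
  rw [hs.mul_mul_cancel_left, ← hA1] at h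
  have hAB := eq_of_commute_rightOp
    (fun t ht => (commute_leftOp_rightOp hs ht).mul_left (hB t ht)) hA h
  rw [← hA2, ← hAB, Module.End.mul_apply, hB2]

theorem Rtilde_eq_of_descent {s v : Equiv.Perm (Fin n)} (hs : IsSimple s)
    (hv : length (s * v) < length v) (u : Equiv.Perm (Fin n)) :
    Rtilde u v = Rtilde (s * u) (s * v) +
      (if length u < length (s * u) then X else 0) * Rtilde u (s * v) :=
  congrFun (RtildeCol_eq_leftOp hs hv) u

/-! ### Inversion of the matrix of `R̃`-polynomials. -/

/-- The recursion rewritten in a form that does not depend on whether `s` is a descent of `x`. -/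
theorem Rtilde_simple_mul_right {s : Equiv.Perm (Fin n)} (hs : IsSimple s)
    (u x : Equiv.Perm (Fin n)) :
    Rtilde u (s * x) - (if length x < length (s * x) then X else 0) * Rtilde u x =
      Rtilde (s * u) x - (if length (s * u) < length u then X else 0) * Rtilde u x := by
  have hlx := length_simple_mul hs x
  have hlu := length_simple_mul hs u
  by_cases hx : length x < length (s * x)
  · have h := Rtilde_eq_of_descent hs (v := s * x) (by rwa [hs.mul_mul_cancel_left]) u
    rw [hs.mul_mul_cancel_left] at h
    rw [h, if_pos hx]
    by_cases hu : length u < length (s * u)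
    · rw [if_pos hu, if_neg (lt_asymm hu)]
      ring
    · rw [if_neg hu, if_pos (by omega)]
      ring
  · have h1 := Rtilde_eq_of_descent hs (v := x) (by omega) u
    have h2 := Rtilde_eq_of_descent hs (v := x) (by omega) (s * u)
    rw [hs.mul_mul_cancel_left] at h2
    rw [if_neg hx, h1, h2]
    by_cases hu : length u < length (s * u)
    · rw [if_pos hu, if_neg (lt_asymm hu)]
      ring
    · rw [if_neg hu, if_pos (by omega)]
      ring

/-- The matrices `R̃(q)` and `R̃(-q)` are inverse to each other. -/
theorem sum_Rtilde_mul_Rtilde_comp_neg (u z : Equiv.Perm (Fin n)) :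
    ∑ x, Rtilde u x * (Rtilde x z).comp (-X) = if u = z then 1 else 0 := by
  induction hk : length z using Nat.strong_induction_on generalizing u z with
  | _ k ih =>
  subst hk
  by_cases hz : z = 1
  · subst hz
    have h : ∀ x : Equiv.Perm (Fin n), Rtilde x 1 = if x = 1 then 1 else 0 := fun x => by
      rw [← Pi.single_apply]
      exact congrFun RtildeCol_one x
    simp only [h, apply_ite (fun p : ℤ[X] => p.comp (-X)), one_comp, zero_comp, mul_ite, mul_one,
      mul_zero, Finset.sum_ite_eq', Finset.mem_univ, if_true]
  obtain ⟨i, j, hij, hinv⟩ := exists_adjacent_inversion hz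
  have hs : IsSimple (Equiv.swap i j) := ⟨i, j, hij, rfl⟩
  have hlt := (length_simple_mul_lt_iff hij).2 hinv
  generalize Equiv.swap i j = s at hs hlt
  have expand : ∀ x, (Rtilde x z).comp (-X) = (Rtilde (s * x) (s * z)).comp (-X) -
      (if length x < length (s * x) then X else 0) * (Rtilde x (s * z)).comp (-X) := fun x => by
    rw [Rtilde_eq_of_descent hs hlt x]
    split_ifs <;> simp [sub_eq_add_neg]
  have reindex : ∑ x, Rtilde u x * (Rtilde (s * x) (s * z)).comp (-X) =
      ∑ x, Rtilde u (s * x) * (Rtilde x (s * z)).comp (-X) :=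
    Fintype.sum_equiv (Equiv.mulLeft s) _ _ fun x => by
      rw [Equiv.coe_mulLeft, hs.mul_mul_cancel_left]
  have hmul : ∀ a b : Equiv.Perm (Fin n), s * a = s * b ↔ a = b := fun a b => mul_right_inj s
  calc ∑ x, Rtilde u x * (Rtilde x z).comp (-X)
      = ∑ x, Rtilde u x * (Rtilde (s * x) (s * z)).comp (-X) -
          ∑ x, Rtilde u x * ((if length x < length (s * x) then X else 0) *
            (Rtilde x (s * z)).comp (-X)) := by
        simp only [expand, mul_sub, Finset.sum_sub_distrib]
    _ = ∑ x, (Rtilde u (s * x) - (if length x < length (s * x) then X else 0) * Rtilde u x) *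
          (Rtilde x (s * z)).comp (-X) := by
        rw [reindex, ← Finset.sum_sub_distrib]
        exact Finset.sum_congr rfl fun x _ => by ring
    _ = ∑ x, Rtilde (s * u) x * (Rtilde x (s * z)).comp (-X) -
          (if length (s * u) < length u then X else 0) *
            ∑ x, Rtilde u x * (Rtilde x (s * z)).comp (-X) := by
        rw [Finset.mul_sum, ← Finset.sum_sub_distrib]
        refine Finset.sum_congr rfl fun x _ => ?_
        -- This moves `s` from `x` to `u`, so the coefficient no longer depends on `x` and leaves
        -- the sum.
        rw [Rtilde_simple_mul_right hs]
        ring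
    _ = if u = z then 1 else 0 := by
        rw [ih _ hlt _ _ rfl, ih _ hlt _ _ rfl]
        simp only [hmul]
        -- The second delta is supported at `u = s z`, where `s u = z` is longer than `u` and the
        -- coefficient is zero.
        by_cases h : u = s * z
        · subst h
          rw [hs.mul_mul_cancel_left, if_neg (lt_asymm hlt), zero_mul, sub_zero]
        · rw [if_neg h, mul_zero, sub_zero]

/-! ### Restriction to an order ideal. -/

theorem mem_bruhatIcc {u v x : Equiv.Perm (Fin n)} :
    x ∈ bruhatIcc u v ↔ BruhatLE u x ∧ BruhatLE x v := by
  simp [bruhatIcc]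

theorem IsOrderIdeal.left_mem {u v : Equiv.Perm (Fin n)} {I : Finset (Equiv.Perm (Fin n))}
    (hI : IsOrderIdeal u v I) (hne : I.Nonempty) : u ∈ I := by
  obtain ⟨x, hx⟩ := hne
  have h := mem_bruhatIcc.1 (hI.1 hx)
  exact hI.2 x hx u (mem_bruhatIcc.2 ⟨Relation.ReflTransGen.refl, h.1.trans h.2⟩) h.1

/-- The relative polynomial may be computed over all of `I`, the additional terms being zero. -/
theorem relRtilde_inter_bruhatIcc {u v : Equiv.Perm (Fin n)} {I : Finset (Equiv.Perm (Fin n))}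
    (hI : IsOrderIdeal u v I) (x : Equiv.Perm (Fin n)) :
    relRtilde x v (I ∩ bruhatIcc x v) = ∑ z ∈ I, (Rtilde x z).comp (-X) * Rtilde z v := by
  refine Finset.sum_subset Finset.inter_subset_left fun z hz hz' => ?_
  have hxz : ¬BruhatLE x z := fun h =>
    hz' (Finset.mem_inter.2 ⟨hz, mem_bruhatIcc.2 ⟨h, (mem_bruhatIcc.1 (hI.1 hz)).2⟩⟩)
  rw [Rtilde_eq_zero hxz, zero_comp, zero_mul]

/-- The inversion formula localises to `I`: every `x` with `u ≤ x ≤ z` lies in `I` by down-closure,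
and all other terms vanish. -/
theorem sum_orderIdeal_Rtilde_mul_comp_neg {u v z : Equiv.Perm (Fin n)}
    {I : Finset (Equiv.Perm (Fin n))} (hI : IsOrderIdeal u v I) (hz : z ∈ I) :
    ∑ x ∈ I, Rtilde u x * (Rtilde x z).comp (-X) = if u = z then 1 else 0 := by
  rw [← sum_Rtilde_mul_Rtilde_comp_neg]
  refine Finset.sum_subset (Finset.subset_univ I) fun x _ hx => ?_
  by_cases hux : BruhatLE u x
  · have hxz : ¬BruhatLE x z := fun h => hx <|
      hI.2 z hz x (mem_bruhatIcc.2 ⟨hux, h.trans (mem_bruhatIcc.1 (hI.1 hz)).2⟩) h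
    rw [Rtilde_eq_zero hxz, zero_comp, mul_zero]
  · rw [Rtilde_eq_zero hux, zero_mul]

end SymBruhat

theorem lemma3p3 {n : ℕ} (u v : Equiv.Perm (Fin n)) (I : Finset (Equiv.Perm (Fin n)))
    (hI : SymBruhat.IsOrderIdeal u v I) (hne : I.Nonempty) :
    SymBruhat.Rtilde u v =
      ∑ x ∈ I, SymBruhat.Rtilde u x *
        SymBruhat.relRtilde x v (I ∩ SymBruhat.bruhatIcc x v) := by
  simp only [SymBruhat.relRtilde_inter_bruhatIcc hI, Finset.mul_sum, ← mul_assoc]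
  rw [Finset.sum_comm]
  simp only [← Finset.sum_mul]
  rw [Finset.sum_congr rfl fun z hz => by
    rw [SymBruhat.sum_orderIdeal_Rtilde_mul_comp_neg hI hz]]
  simp [hI.left_mem hne]
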